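/- All graphs are finite and simple. Write $G\rightarrow(G_1,\dots,G_t)$ if for every colouring of the edges of $G$ with colours $1,\dots,t$ there is an $i$ such that the spanning subgraph of $G$ formed by the edges of colour $i$ contains a copy of $G_i$ as a (not necessarily induced) subgraph. The Ramsey number $R(G_1,\dots,G_t)$ is the smallest positive integer $n$ with $K_n\rightarrow(G_1,\dots,G_t)$, and, with $N=R(G_1,\dots,G_t)$, the star-critical Ramsey number is $$R_*(G_1,\dots,G_t)=\min\{\delta(H): H\subseteq K_N,\ H\rightarrow(G_1,\dots,G_t)\},$$ where $\delta(H)$ is the minimum degree of $H$. For a forest $F$ let $k_i(F)$ be the number of components of $F$ with exactly $i$ vertices, $C(F)=\{i: k_i(F)\neq 0\}$, and let $n(F)$ be the number of vertices of a largest component of $F$. **Theorem.** Let $F$ be a nonempty forest without isolated vertices, let $m_1,\dots,m_t$ be positive integers, let $r=R(K_{m_1},\dots,K_{m_t})$, and suppose that $r\ge 3$. Let $j_0$ be the smallest $j\in C(F)$ that attains $$\max_{j\in C(F)}\Big\{(j-1)(r-2)+\sum_{i=j}^{n(F)} i\,k_i(F)\Big\}.$$ Then $$R_*(F,K_{m_1},\dots,K_{m_t})=(j_0-1)(r-3)+\sum_{i=j_0}^{n(F)}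 i\,k_i(F).$$ -/

import Mathlib

universe u

namespace ForestRamsey

/-- A graph together with its vertex type. -/
abbrev BundledGraph := Σ V : Type u, SimpleGraph V

/-- The complete graph `K_m` on `m` vertices (with vertices in an arbitrary universe). -/
def K (m : ℕ) : BundledGraph.{u} := ⟨ULift.{u} (Fin m), ⊤⟩

/-- `G → (G_1, …, G_t)`: for every colouring of the edges of `G` with `t` colours there is a
colour `i` such that the spanning subgraph of `G` formed by the edges of colour `i` contains a
(not necessarily induced) copy of `G_i`. -/
def Arrows {V : Type*} (G : SimpleGraph V) {t : ℕ} (A : Fin t → BundledGraph.{u}) : Prop :=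
  ∀ c : G.EdgeLabeling (Fin t), ∃ i, (A i).2.IsContained (c.labelGraph i)

/-- The Ramsey number `R(G_1, …, G_t)`: the smallest positive integer `n` such that
`K_n → (G_1, …, G_t)`. -/
noncomputable def ramseyNumber {t : ℕ} (A : Fin t → BundledGraph.{u}) : ℕ :=
  sInf {n : ℕ | 0 < n ∧ Arrows (⊤ : SimpleGraph (Fin n)) A}

open Classical in
/-- The star-critical Ramsey number `R_*(G_1, …, G_t)`: the minimum of the minimum degrees `δ(H)`
over all subgraphs `H` of `K_r`, `r = R(G_1, …, G_t)`, such that `H → (G_1, …, G_t)`. -/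
noncomputable def starCriticalRamseyNumber {t : ℕ} (A : Fin t → BundledGraph.{u}) : ℕ :=
  sInf {d : ℕ | ∃ H : (⊤ : SimpleGraph (Fin (ramseyNumber A))).Subgraph,
    Arrows H.coe A ∧ H.coe.minDegree = d}

/-- `k_i(F)`: the number of connected components of `F` with exactly `i` vertices. -/
noncomputable def numComponents {V : Type*} (F : SimpleGraph V) (i : ℕ) : ℕ :=
  {c : F.ConnectedComponent | c.supp.ncard = i}.ncard

/-- `n(F)`: the number of vertices of a largest connected component of `F`. -/
noncomputable def maxComponentSize {V : Type*} (F : SimpleGraph V) : ℕ :=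
  sSup (Set.range fun c : F.ConnectedComponent => c.supp.ncard)

/-- `C(F) = {i : k_i(F) ≠ 0}`: the set of sizes of the components of `F`. -/
def componentSizes {V : Type*} (F : SimpleGraph V) : Set ℕ :=
  {i | numComponents F i ≠ 0}

/-- `∑_{i = j}^{n(F)} i k_i(F)`. -/
noncomputable def tailSum {V : Type*} (F : SimpleGraph V) (j : ℕ) : ℕ :=
  ∑ i ∈ Finset.Icc j (maxComponentSize F), i * numComponents F i

end ForestRamsey

namespace ForestRamsey

open scoped Classical

/-! Write `r = s + 3` and `N = (j₀ - 1)(s + 1) + tailSum F j₀`. The Ramsey number is `N`, and a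
vertex of a graph on `N` vertices may miss exactly `j₀ - 2` others before arrowing fails. This
leaves degree `N - 1 - (j₀ - 2) = (j₀ - 1)s + tailSum F j₀`.

Lower bounds: blow up a good colouring of `K_{r-1}`, giving the forest colour to edges inside parts.
One part has `tailSum F j₀ - 1` vertices, too few for all components of order at least `j₀`; the
others have `j₀ - 1`, too few for any such component. A vertex `v` with `j₀ - 1` nonneighbours fits
as one more vertex: it joins a part formed by those nonneighbours and has no edge there
(`not_arrows_cons_of_nonneighbors`).

Upper bounds: embed the components of `F` greedily in decreasing order. When one of order `j` is
due, at least `(j - 1)(s + 2) + 1` vertices remain, so by Chvátal's theorem either it embeds or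
there are `r` vertices independent in the forest colour; if these form a clique of the host graph,
the other colours finish. Only `v` can spoil the clique. If `j < j₀`, minimality of `j₀` gives a
spare vertex and `v` is discarded. If `j ≥ j₀`, the remaining graph without `v` is extremal:
disjoint cliques of order `j - 1`, none joined to `v` in the forest colour. At most `j₀ - 2`
nonneighbours of `v` cannot fill such a clique, so one vertex per clique can be chosen to complete
`v` to the required set. -/

/-! ### Embedding trees; Chvátal's theorem and its extremal case -/

/-- `G` contains a (not necessarily induced) copy of `T` with all its vertices in `U`. -/
def EmbedsIn {W X : Type*} (T : SimpleGraph W) (G : SimpleGraph X) (U : Finset X) : Prop :=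
  ∃ f : W → X, Function.Injective f ∧ (∀ a b, T.Adj a b → G.Adj (f a) (f b)) ∧ ∀ a, f a ∈ U

theorem EmbedsIn.mono {W X : Type*} {T : SimpleGraph W} {G : SimpleGraph X} {U U' : Finset X}
    (h : EmbedsIn T G U) (hU : U ⊆ U') : EmbedsIn T G U' :=
  let ⟨f, hf, hadj, hmem⟩ := h
  ⟨f, hf, hadj, fun a => hU (hmem a)⟩

/-- The neighbours of `x` in `U`. -/
noncomputable def nbrsIn {X : Type*} (G : SimpleGraph X) (U : Finset X) (x : X) : Finset X :=
  U.filter (G.Adj x)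

@[simp] theorem mem_nbrsIn {X : Type*} {G : SimpleGraph X} {U : Finset X} {x y : X} :
    y ∈ nbrsIn G U x ↔ y ∈ U ∧ G.Adj x y := by
  simp [nbrsIn]

/-- The closed neighbourhood of `x` in `U`. -/
noncomputable def closedNbrsIn {X : Type*} (G : SimpleGraph X) (U : Finset X) (x : X) :
    Finset X :=
  U.filter fun y => y = x ∨ G.Adj x y

@[simp] theorem mem_closedNbrsIn {X : Type*} {G : SimpleGraph X} {U : Finset X} {x y : X} :
    y ∈ closedNbrsIn G U x ↔ y ∈ U ∧ (y = x ∨ G.Adj x y) := by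
  simp [closedNbrsIn]

/-- A graph of minimum degree at least `n - 1` contains every tree on `n` vertices. -/
theorem embedsIn_of_le_card_nbrsIn {X : Type*} (G : SimpleGraph X) (U : Finset X)
    (hU : U.Nonempty) (n : ℕ) {W : Type*} [Finite W] (T : SimpleGraph W) (hT : T.IsTree)
    (hn : Nat.card W = n) (hdeg : ∀ x ∈ U, n ≤ (nbrsIn G U x).card + 1) : EmbedsIn T G U := by
  induction n generalizing W with
  | zero =>
    have := hT.connected.nonempty
    exact absurd hn Nat.card_pos.ne'
  | succ n ih =>
    have hfin : Fintype W := Fintype.ofFinite W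
    obtain ⟨u, hu⟩ := hU
    rcases subsingleton_or_nontrivial W with hs | hnt
    · exact ⟨fun _ => u, fun a b _ => Subsingleton.elim a b,
        fun a b hab => absurd (Subsingleton.elim a b) hab.ne, fun _ => hu⟩
    obtain ⟨l, hl⟩ := hT.exists_vert_degree_one_of_nontrivial
    have hT' : (T.induce {l}ᶜ).IsTree :=
      ⟨hT.connected.induce_compl_singleton_of_degree_eq_one hl, hT.isAcyclic.induce _⟩
    obtain ⟨p, hlp, hp⟩ := SimpleGraph.degree_eq_one_iff_existsUnique_adj.mp hl
    have hcard : Nat.card ({l}ᶜ : Set W) = n := by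
      rw [Nat.card_coe_set_eq, Set.ncard_compl, hn, Set.ncard_singleton]
      rfl
    obtain ⟨f, hf, hadj, hmem⟩ := ih (T.induce {l}ᶜ) hT' hcard
      fun x hx => (Nat.le_succ n).trans (hdeg x hx)
    let p' : ({l}ᶜ : Set W) := ⟨p, fun h => hlp.ne h.symm⟩
    -- The copy of the tree without its leaf uses `n - 1` vertices besides `f p'`, and `f p'` has at
    -- least `n` neighbours in `U`, so one is free for the leaf.
    have hex : ∃ w ∈ nbrsIn G U (f p'), w ∉ (Finset.univ.image f).erase (f p') := by
      by_contra! hcon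
      have h1 := Finset.card_le_card (fun w hw => hcon w hw)
      have h2 : (Finset.univ.image f).card = n := by
        rw [Finset.card_image_of_injective _ hf, Finset.card_univ, ← Nat.card_eq_fintype_card,
          hcard]
      have h3 : f p' ∈ Finset.univ.image f := Finset.mem_image_of_mem _ (Finset.mem_univ _)
      have h4 := Finset.card_erase_add_one h3
      have h5 := hdeg _ (hmem p')
      omega
    obtain ⟨w, hw, hwf⟩ := hex
    rw [mem_nbrsIn] at hw
    have hwf' : ∀ a, f a ≠ w := by
      rintro a rfl
      exact hwf (Finset.mem_erase.2 ⟨hw.2.ne', Finset.mem_image_of_mem _ (Finset.mem_univ _)⟩)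
    refine ⟨fun a => if h : a = l then w else f ⟨a, h⟩, ?_, ?_, ?_⟩
    · intro a b hab
      by_cases ha : a = l <;> by_cases hb : b = l <;> simp only [ha, hb, dite_true, dite_false]
        at hab ⊢
      · exact absurd hab.symm (hwf' _)
      · exact absurd hab (hwf' _)
      · exact congrArg Subtype.val (hf hab)
    · intro a b hab
      by_cases ha : a = l <;> by_cases hb : b = l <;> simp only [ha, hb, dite_true, dite_false]
      · exact absurd (ha.trans hb.symm) hab.ne
      · obtain rfl : b = p := hp b (ha ▸ hab)
        exact hw.2.symm
      · obtain rfl : a = p := hp a (hb ▸ hab.symm)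
        exact hw.2
      · exact hadj ⟨a, ha⟩ ⟨b, hb⟩ hab
    · intro a
      by_cases ha : a = l <;> simp only [ha, dite_true, dite_false]
      · exact hw.1
      · exact hmem _

/-- A set of vertices without a copy of a tree on `n` vertices contains a vertex with fewer than
`n - 1` neighbours in it. -/
theorem exists_card_closedNbrsIn_lt {X : Type*} {G : SimpleGraph X} {U : Finset X}
    (hU : U.Nonempty) {W : Type*} [Finite W] {T : SimpleGraph W} (hT : T.IsTree)
    (hfree : ¬ EmbedsIn T G U) :
    ∃ u ∈ U, (closedNbrsIn G U u).card + 1 ≤ Nat.card W := by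
  by_contra! hcon
  refine hfree (embedsIn_of_le_card_nbrsIn G U hU _ T hT rfl fun x hx => ?_)
  have h : closedNbrsIn G U x ⊆ insert x (nbrsIn G U x) := by
    intro y hy
    simp only [mem_closedNbrsIn, Finset.mem_insert, mem_nbrsIn] at hy ⊢
    tauto
  have h1 := Finset.card_le_card h
  have h2 := Finset.card_insert_le x (nbrsIn G U x)
  have h3 := hcon x hx
  omega

theorem isIndepSet_insert_of_closedNbrsIn {X : Type*} {G : SimpleGraph X} {U I : Finset X} {u : X}
    (hI : I ⊆ U \ closedNbrsIn G U u) (hind : G.IsIndepSet (I : Set X)) :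
    G.IsIndepSet (insert u I : Finset X) := by
  have key : ∀ y ∈ I, ¬ G.Adj u y := fun y hy h => by
    have := hI hy
    simp only [Finset.mem_sdiff, mem_closedNbrsIn] at this
    tauto
  intro a ha b hb hab
  simp only [Finset.coe_insert, Set.mem_insert_iff, Finset.mem_coe] at ha hb
  rcases ha with rfl | ha <;> rcases hb with rfl | hb
  · exact absurd rfl hab
  · exact key b hb
  · exact fun h => key a ha h.symm
  · exact hind ha hb hab

/-- Chvátal's theorem: a set of vertices without a copy of a tree on `n` vertices contains an
independent set with at least one `(n - 1)`-th of its elements. -/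
theorem exists_isIndepSet_of_not_embedsIn {X : Type*} {G : SimpleGraph X} {W : Type*} [Finite W]
    {T : SimpleGraph W} (hT : T.IsTree) (U : Finset X) (hfree : ¬ EmbedsIn T G U) :
    ∃ I ⊆ U, G.IsIndepSet (I : Set X) ∧ U.card ≤ (Nat.card W - 1) * I.card := by
  induction U using Finset.strongInduction with
  | H U ih =>
    rcases U.eq_empty_or_nonempty with rfl | hU
    · exact ⟨∅, subset_rfl, by simp, by simp⟩
    -- Greedy choice: each vertex put into the independent set costs a closed neighbourhood of at
    -- most `Nat.card W - 1` vertices.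
    obtain ⟨u, hu, hcard⟩ := exists_card_closedNbrsIn_lt hU hT hfree
    have hsub : closedNbrsIn G U u ⊆ U := Finset.filter_subset _ _
    have huN : u ∈ closedNbrsIn G U u := by simp [hu]
    obtain ⟨I, hIU, hI, hIc⟩ := ih (U \ closedNbrsIn G U u)
      (Finset.sdiff_ssubset hsub ⟨u, huN⟩) fun h => hfree (h.mono Finset.sdiff_subset)
    have huI : u ∉ I := fun h => (Finset.mem_sdiff.1 (hIU h)).2 huN
    refine ⟨insert u I, Finset.insert_subset hu (hIU.trans Finset.sdiff_subset),
      isIndepSet_insert_of_closedNbrsIn hIU hI, ?_⟩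
    rw [Finset.card_insert_of_notMem huI, mul_add]
    have := Finset.card_sdiff_add_card_eq_card hsub
    omega

/-- A clique on `n - 1` vertices together with one pendant edge contains every tree on `n`
vertices. -/
theorem embedsIn_insert_of_isClique {X : Type*} {G : SimpleGraph X} {Q : Finset X}
    (hQ : G.IsClique (Q : Set X)) {q w : X} (hq : q ∈ Q) (hw : w ∉ Q) (hqw : G.Adj q w)
    {W : Type*} [Finite W] {T : SimpleGraph W} (hT : T.IsTree) (hcard : Q.card + 1 = Nat.card W) :
    EmbedsIn T G (insert w Q) := by
  have hfin : Fintype W := Fintype.ofFinite W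
  have hQpos : 0 < Q.card := Finset.card_pos.2 ⟨q, hq⟩
  have hnt : Nontrivial W := Finite.one_lt_card_iff_nontrivial.1 (by omega)
  obtain ⟨l, hl⟩ := hT.exists_vert_degree_one_of_nontrivial
  obtain ⟨p, hlp, hp⟩ := SimpleGraph.degree_eq_one_iff_existsUnique_adj.mp hl
  have e₀ : W ≃ (insert w Q : Finset X) := Fintype.equivOfCardEq (by
    rw [← Nat.card_eq_fintype_card, ← hcard, Fintype.card_coe, Finset.card_insert_of_notMem hw])
  let w' : (insert w Q : Finset X) := ⟨w, Finset.mem_insert_self _ _⟩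
  let q' : (insert w Q : Finset X) := ⟨q, Finset.mem_insert_of_mem hq⟩
  have hqw' : q' ≠ w' := fun h => hqw.ne (congrArg Subtype.val h)
  -- The leaf edge is the only tree edge at `l`, so any bijection with these two values works. The
  -- second swap does not move `w'`.
  obtain ⟨e, hel, hep⟩ : ∃ e : W ≃ (insert w Q : Finset X), e l = w' ∧ e p = q' := by
    let e₁ := e₀.trans (Equiv.swap (e₀ l) w')
    have h1 : e₁ l = w' := by simp [e₁]
    refine ⟨e₁.trans (Equiv.swap (e₁ p) q'), ?_, by simp⟩
    have h2 : w' ≠ e₁ p := by rw [← h1]; exact fun h => hlp.ne (e₁.injective h)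
    simp only [Equiv.trans_apply, h1]
    exact Equiv.swap_apply_of_ne_of_ne h2 hqw'.symm
  have hmemQ : ∀ a, a ≠ l → (e a : X) ∈ Q := fun a ha => by
    refine (Finset.mem_insert.1 (e a).2).resolve_left fun h => ha (e.injective ?_)
    rw [hel]
    exact Subtype.ext h
  refine ⟨fun a => e a, fun a b h => e.injective (Subtype.ext h), fun a b hab => ?_,
    fun a => (e a).2⟩
  by_cases ha : a = l
  · obtain rfl : b = p := hp b (ha ▸ hab)
    simp only [ha, hel, hep]
    exact hqw.symm
  by_cases hb : b = l
  · obtain rfl : a = p := hp a (hb ▸ hab.symm)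
    simp only [hb, hel, hep]
    exact hqw
  · exact hQ (hmemQ a ha) (hmemQ b hb) fun h => hab.ne (e.injective (Subtype.ext h))

/-- The extremal case of Chvátal's theorem: the graph is a disjoint union of cliques on `n - 1`
vertices. -/
theorem closedNbrsIn_isClique_of_not_embedsIn {X : Type*} {G : SimpleGraph X} {W : Type*}
    [Finite W] {T : SimpleGraph W} (hT : T.IsTree) (hW : 2 ≤ Nat.card W) (U : Finset X)
    (hfree : ¬ EmbedsIn T G U)
    (hind : ∀ I ⊆ U, G.IsIndepSet (I : Set X) → (Nat.card W - 1) * I.card ≤ U.card) :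
    ∀ x ∈ U, G.IsClique (closedNbrsIn G U x : Set X) ∧
      (closedNbrsIn G U x).card + 1 = Nat.card W := by
  induction U using Finset.strongInduction with
  | H U ih =>
    rcases U.eq_empty_or_nonempty with rfl | hU
    · simp
    obtain ⟨u, hu, hcard⟩ := exists_card_closedNbrsIn_lt hU hT hfree
    set Q := closedNbrsIn G U u with hQdef
    have hsub : Q ⊆ U := Finset.filter_subset _ _
    have huQ : u ∈ Q := by simp [hQdef, hu]
    have hsum := Finset.card_sdiff_add_card_eq_card hsub
    have hfree' : ¬ EmbedsIn T G (U \ Q) := fun h => hfree (h.mono Finset.sdiff_subset)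
    have hIH := ih (U \ Q) (Finset.sdiff_ssubset hsub ⟨u, huQ⟩) hfree' (by
      intro I hI hIind
      have huI : u ∉ I := fun h => (Finset.mem_sdiff.1 (hI h)).2 huQ
      have := hind (insert u I) (Finset.insert_subset hu (hI.trans Finset.sdiff_subset))
        (isIndepSet_insert_of_closedNbrsIn hI hIind)
      rw [Finset.card_insert_of_notMem huI, mul_add] at this
      omega)
    -- By induction `x` lies in a clique of order `Nat.card W - 1`; an edge leaving it would be the
    -- pendant edge that completes a copy of the tree.
    have hno : ∀ x ∈ U \ Q, ∀ y ∈ Q, ¬ G.Adj x y := by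
      intro x hx y hy hxy
      obtain ⟨h1, h2⟩ := hIH x hx
      have hyn : y ∉ closedNbrsIn G (U \ Q) x := fun h => by
        simp only [mem_closedNbrsIn, Finset.mem_sdiff] at h
        exact h.1.2 hy
      refine hfree ((embedsIn_insert_of_isClique h1 (q := x) (by simpa using hx) hyn hxy hT
        h2).mono ?_)
      exact Finset.insert_subset (hsub hy)
        ((Finset.filter_subset _ _).trans Finset.sdiff_subset)
    obtain ⟨I, hIU, hI, hIc⟩ := exists_isIndepSet_of_not_embedsIn hT _ hfree'
    have hdisj : ∀ z ∈ Q, z ∉ I := fun z hz h => (Finset.mem_sdiff.1 (hIU h)).2 hz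
    -- With `u` added, the independent set from Chvátal's bound on `U \ Q` would be too large if `Q`
    -- were smaller.
    have hQcard : Q.card + 1 = Nat.card W := by
      have := hind (insert u I) (Finset.insert_subset hu (hIU.trans Finset.sdiff_subset))
        (isIndepSet_insert_of_closedNbrsIn hIU hI)
      rw [Finset.card_insert_of_notMem (hdisj u huQ), mul_add] at this
      omega
    -- Two nonadjacent vertices of `Q` could both be added to `I`, exceeding the allowed
    -- independence number.
    have hQclique : G.IsClique (Q : Set X) := by
      intro y hy z hz hyz
      by_contra hnadj
      have hzI := hdisj z hz
      have hyI : y ∉ insert z I := by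
        rw [Finset.mem_insert, not_or]
        exact ⟨hyz, hdisj y hy⟩
      have hind' : G.IsIndepSet (insert y (insert z I) : Finset X) := by
        have hIno : ∀ a ∈ I, ∀ b ∈ Q, ¬ G.Adj a b := fun a ha b hb => hno a (hIU ha) b hb
        intro a ha b hb hab
        simp only [Finset.coe_insert, Set.mem_insert_iff, Finset.mem_coe] at ha hb
        rcases ha with rfl | rfl | ha <;> rcases hb with rfl | rfl | hb
        · exact absurd rfl hab
        · exact hnadj
        · exact fun h => hIno b hb a hy h.symm
        · exact fun h => hnadj h.symm
        · exact absurd rfl hab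
        · exact fun h => hIno b hb a hz h.symm
        · exact hIno a ha b hy
        · exact hIno a ha b hz
        · exact hI ha hb hab
      have := hind _ (Finset.insert_subset (hsub hy) (Finset.insert_subset (hsub hz)
        (hIU.trans Finset.sdiff_subset))) hind'
      rw [Finset.card_insert_of_notMem hyI, Finset.card_insert_of_notMem hzI, mul_add,
        mul_add] at this
      omega
    intro x hx
    by_cases hxQ : x ∈ Q
    · have : closedNbrsIn G U x = Q := by
        ext y
        rw [mem_closedNbrsIn]
        constructor
        · rintro ⟨hy, rfl | hxy⟩
          · exact hxQ
          · by_contra hyQ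
            exact hno y (Finset.mem_sdiff.2 ⟨hy, hyQ⟩) x hxQ hxy.symm
        · intro hy
          refine ⟨hsub hy, ?_⟩
          by_cases hyx : y = x
          · exact Or.inl hyx
          · exact Or.inr (hQclique hxQ hy (Ne.symm hyx))
      rw [this]
      exact ⟨hQclique, hQcard⟩
    · have hx' : x ∈ U \ Q := Finset.mem_sdiff.2 ⟨hx, hxQ⟩
      have : closedNbrsIn G U x = closedNbrsIn G (U \ Q) x := by
        ext y
        simp only [mem_closedNbrsIn, Finset.mem_sdiff]
        constructor
        · rintro ⟨hy, rfl | hxy⟩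
          · exact ⟨⟨hy, hxQ⟩, Or.inl rfl⟩
          · exact ⟨⟨hy, fun hyQ => hno x hx' y hyQ hxy⟩, Or.inr hxy⟩
        · rintro ⟨⟨hy, -⟩, h⟩
          exact ⟨hy, h⟩
      rw [this]
      exact hIH x hx'

/-- In the extremal case of Chvátal's theorem, an additional vertex `v` that does not create a copy
of the tree extends a large independent set which avoids a given set of at most `n - 2` vertices. -/
theorem exists_isIndepSet_insert_of_not_embedsIn {X : Type*} {G : SimpleGraph X} {W : Type*}
    [Finite W] {T : SimpleGraph W} (hT : T.IsTree) (hW : 2 ≤ Nat.card W) {U D : Finset X} {v : X}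
    (hv : v ∉ U) (hD : D.card + 2 ≤ Nat.card W) (hfree : ¬ EmbedsIn T G (insert v U))
    (hind : ∀ I ⊆ U, G.IsIndepSet (I : Set X) → (Nat.card W - 1) * I.card ≤ U.card) :
    ∃ I ⊆ U \ D, G.IsIndepSet (insert v I : Finset X) ∧ U.card ≤ (Nat.card W - 1) * I.card := by
  have hstr := closedNbrsIn_isClique_of_not_embedsIn hT hW U
    (fun h => hfree (h.mono (Finset.subset_insert _ _))) hind
  have hvno : ∀ x ∈ U, ¬ G.Adj v x := by
    intro x hx hvx
    obtain ⟨h1, h2⟩ := hstr x hx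
    have hsub : closedNbrsIn G U x ⊆ U := Finset.filter_subset _ _
    exact hfree ((embedsIn_insert_of_isClique h1 (q := x) (by simpa using hx)
      (fun h => hv (hsub h)) hvx.symm hT h2).mono (Finset.insert_subset_insert _ hsub))
  -- A maximum independent set avoiding `D` meets every clique, since each clique has more vertices
  -- than `D`.
  obtain ⟨I, hI, hmax⟩ := Finset.exists_max_image
    ((U \ D).powerset.filter fun I : Finset X => G.IsIndepSet (I : Set X)) Finset.card
    ⟨∅, by simp⟩
  simp only [Finset.mem_filter, Finset.mem_powerset, and_imp] at hI hmax
  obtain ⟨hIU, hIind⟩ := hI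
  refine ⟨I, hIU, ?_, ?_⟩
  · have key : ∀ y ∈ I, ¬ G.Adj v y := fun y hy => hvno y (Finset.mem_sdiff.1 (hIU hy)).1
    intro a ha b hb hab
    simp only [Finset.coe_insert, Set.mem_insert_iff, Finset.mem_coe] at ha hb
    rcases ha with rfl | ha <;> rcases hb with rfl | hb
    · exact absurd rfl hab
    · exact key b hb
    · exact fun h => key a ha h.symm
    · exact hIind ha hb hab
  · have hcover : U ⊆ I.biUnion (closedNbrsIn G U) := by
      intro x hx
      obtain ⟨h1, h2⟩ := hstr x hx
      obtain ⟨y, hy, hyD⟩ : ∃ y ∈ closedNbrsIn G U x, y ∉ D := by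
        by_contra! hcon
        have := Finset.card_le_card hcon
        omega
      have hxx : x ∈ closedNbrsIn G U x := by simpa using hx
      have hyU : y ∈ U := (mem_closedNbrsIn.1 hy).1
      obtain ⟨z, hzI, hz⟩ : ∃ z ∈ I, y = z ∨ G.Adj z y := by
        by_contra! hcon
        have hyI : y ∉ I := fun h => (hcon y h).1 rfl
        have := hmax (insert y I)
          (Finset.insert_subset (Finset.mem_sdiff.2 ⟨hyU, hyD⟩) hIU) (by
            intro a ha b hb hab
            simp only [Finset.coe_insert, Set.mem_insert_iff, Finset.mem_coe] at ha hb
            rcases ha with rfl | ha <;> rcases hb with rfl | hb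
            · exact absurd rfl hab
            · exact fun h => (hcon b hb).2 h.symm
            · exact (hcon a ha).2
            · exact hIind ha hb hab)
        rw [Finset.card_insert_of_notMem hyI] at this
        omega
      have hzU : z ∈ U := (Finset.mem_sdiff.1 (hIU hzI)).1
      refine Finset.mem_biUnion.2 ⟨z, hzI, mem_closedNbrsIn.2 ⟨hx, ?_⟩⟩
      by_cases hxz : x = z
      · exact Or.inl hxz
      refine Or.inr ?_
      have hcl := (hstr y hyU).1
      have hxy : x ∈ closedNbrsIn G U y := by
        simp only [mem_closedNbrsIn] at hy ⊢
        exact ⟨hx, hy.2.imp Eq.symm fun h => h.symm⟩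
      have hzy : z ∈ closedNbrsIn G U y := by
        rw [mem_closedNbrsIn]
        exact ⟨hzU, hz.imp Eq.symm fun h => h.symm⟩
      exact hcl hzy hxy (Ne.symm hxz)
    calc U.card ≤ (I.biUnion (closedNbrsIn G U)).card := Finset.card_le_card hcover
      _ ≤ I.card * (Nat.card W - 1) := Finset.card_biUnion_le_card_mul _ _ _ fun z hz => by
          have := (hstr z (Finset.mem_sdiff.1 (hIU hz)).1).2
          omega
      _ = (Nat.card W - 1) * I.card := mul_comm _ _

/-! ### Component sizes, tail sums and greedy embedding of forests -/

theorem ncard_supp_le_maxComponentSize {V : Type*} [Finite V] (F : SimpleGraph V)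
    (c : F.ConnectedComponent) : c.supp.ncard ≤ maxComponentSize F :=
  le_csSup (Set.finite_range _).bddAbove ⟨c, rfl⟩

theorem mem_componentSizes_iff {V : Type*} [Finite V] {F : SimpleGraph V} {j : ℕ} :
    j ∈ componentSizes F ↔ ∃ c : F.ConnectedComponent, c.supp.ncard = j := by
  rw [componentSizes, Set.mem_ofPred_eq, numComponents, Ne, Set.ncard_eq_zero (Set.toFinite _),
    ← Ne, ← Set.nonempty_iff_ne_empty]
  rfl

/-- The tail sum counts the vertices in components with at least `j` vertices. -/
theorem tailSum_eq_ncard {V : Type*} [Finite V] (F : SimpleGraph V) (j : ℕ) :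
    tailSum F j = {x : V | j ≤ (F.connectedComponentMk x).supp.ncard}.ncard := by
  have hfin : Fintype V := Fintype.ofFinite V
  rw [tailSum, Set.ncard_eq_toFinset_card', Finset.card_eq_sum_card_fiberwise
    (f := fun x => (F.connectedComponentMk x).supp.ncard)
    (t := Finset.Icc j (maxComponentSize F))]
  · refine Finset.sum_congr rfl fun i hi => ?_
    have hc : numComponents F i
        = (Finset.univ.filter fun c : F.ConnectedComponent => c.supp.ncard = i).card := by
      rw [numComponents, Set.ncard_eq_toFinset_card']
      congr 1
      ext c
      simp
    rw [hc, mul_comm, ← smul_eq_mul, ← Finset.sum_const, Finset.card_eq_sum_card_fiberwise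
      (f := F.connectedComponentMk)
      (t := Finset.univ.filter fun c : F.ConnectedComponent => c.supp.ncard = i)]
    · refine Finset.sum_congr rfl fun c hc => ?_
      simp only [Finset.mem_filter, Finset.mem_univ, true_and] at hc
      refine hc.symm.trans ?_
      rw [Set.ncard_eq_toFinset_card']
      congr 1
      ext x
      simp only [Set.mem_toFinset, SimpleGraph.ConnectedComponent.mem_supp_iff,
        Finset.mem_filter, Set.mem_ofPred_eq]
      constructor
      · rintro rfl
        exact ⟨⟨(Finset.mem_Icc.1 hi).1.trans hc.ge, hc⟩, rfl⟩
      · exact fun h => h.2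
    · intro x hx
      simpa using (Finset.mem_filter.1 hx).2
  · intro x hx
    simp only [Set.coe_toFinset, Set.mem_ofPred_eq] at hx
    exact Finset.mem_coe.2 (Finset.mem_Icc.2 ⟨hx, ncard_supp_le_maxComponentSize F _⟩)

theorem ncard_supp_le_tailSum {V : Type*} [Finite V] (F : SimpleGraph V)
    (c : F.ConnectedComponent) : c.supp.ncard ≤ tailSum F c.supp.ncard := by
  rw [tailSum_eq_ncard]
  refine Set.ncard_le_ncard (fun x hx => ?_) (Set.toFinite _)
  rw [SimpleGraph.ConnectedComponent.mem_supp_iff] at hx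
  simp [hx]

theorem two_le_ncard_supp {V : Type*} [Finite V] {F : SimpleGraph V}
    (hF : ∀ v, ∃ w, F.Adj v w) (c : F.ConnectedComponent) : 2 ≤ c.supp.ncard := by
  induction c using SimpleGraph.ConnectedComponent.ind with
  | h v =>
    obtain ⟨w, hw⟩ := hF v
    rw [← Set.ncard_pair hw.ne]
    refine Set.ncard_le_ncard ?_ (Set.toFinite _)
    rintro x (rfl | rfl)
    · exact rfl
    · exact SimpleGraph.ConnectedComponent.sound hw.symm.reachable

/-- A graph `F` is contained in `G` if its components can be embedded one by one, in order of
decreasing size, into the vertices of `G` that are left over. -/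
theorem isContained_of_forall_component {V X : Type*} [Finite V] [Fintype X]
    (F : SimpleGraph V) (G : SimpleGraph X)
    (h : ∀ (c : F.ConnectedComponent) (U : Finset X),
      Fintype.card X + c.supp.ncard ≤ U.card + tailSum F c.supp.ncard →
        EmbedsIn c.toSimpleGraph G U) :
    F.IsContained G := by
  have hfin : Fintype V := Fintype.ofFinite V
  rcases isEmpty_or_nonempty V with hV | ⟨⟨v₀⟩⟩
  · exact SimpleGraph.IsContained.of_isEmpty
  have hX : Nonempty X := by
    obtain ⟨f, -⟩ := h (F.connectedComponentMk v₀) Finset.univ (by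
      have := ncard_supp_le_tailSum F (F.connectedComponentMk v₀)
      rw [Finset.card_univ]
      omega)
    exact ⟨f ⟨v₀, rfl⟩⟩
  suffices hS : ∀ S : Finset F.ConnectedComponent, ∃ f : V → X,
      Set.InjOn f {x | F.connectedComponentMk x ∈ S} ∧
      ∀ x y, F.connectedComponentMk x ∈ S → F.Adj x y → G.Adj (f x) (f y) by
    obtain ⟨f, hf, hadj⟩ := hS Finset.univ
    exact ⟨⟨⟨f, fun {x y} hxy => hadj x y (Finset.mem_univ _) hxy⟩,
      fun x y hxy => hf (Finset.mem_univ _) (Finset.mem_univ _) hxy⟩⟩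
  intro S
  induction S using Finset.induction_on_min_value
    (f := fun c : F.ConnectedComponent => c.supp.ncard) with
  | empty => exact ⟨fun _ => Classical.arbitrary X, by simp, by simp⟩
  | insert c S hcS hmin ih =>
    obtain ⟨f, hf, hadj⟩ := ih
    set A : Finset V := Finset.univ.filter fun x => F.connectedComponentMk x ∈ S with hA
    obtain ⟨g, hg, hgadj, hgmem⟩ := h c (Finset.univ \ A.image f) (by
      have h1 : (A.image f).card ≤ A.card := Finset.card_image_le
      have h2 := Finset.card_sdiff_add_card_eq_card (Finset.subset_univ (A.image f))
      rw [Finset.card_univ] at h2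
      -- All components placed so far are at least as large as `c`, so together with `c` they are
      -- counted by the tail sum.
      have h3 : A.card + c.supp.ncard ≤ tailSum F c.supp.ncard := by
        rw [tailSum_eq_ncard, ← Set.ncard_coe_finset, ← Set.ncard_union_eq]
        · refine Set.ncard_le_ncard ?_ (Set.toFinite _)
          rintro x (hx | hx)
          · simp only [hA, Finset.coe_filter, Finset.mem_univ, true_and, Set.mem_ofPred_eq] at hx
            exact hmin _ hx
          · rw [SimpleGraph.ConnectedComponent.mem_supp_iff] at hx
            simp [hx]
        · rw [Set.disjoint_left]
          intro x hx hxc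
          simp only [hA, Finset.coe_filter, Finset.mem_univ, true_and, Set.mem_ofPred_eq] at hx
          rw [SimpleGraph.ConnectedComponent.mem_supp_iff] at hxc
          exact hcS (hxc ▸ hx)
      omega)
    have hgf : ∀ a x, F.connectedComponentMk x ∈ S → g a ≠ f x := fun a x hx heq =>
      (Finset.mem_sdiff.1 (hgmem a)).2
        (heq ▸ Finset.mem_image_of_mem f (Finset.mem_filter.2 ⟨Finset.mem_univ _, hx⟩))
    refine ⟨fun x => if hx : F.connectedComponentMk x = c then g ⟨x, hx⟩ else f x, ?_, ?_⟩
    · intro x hx y hy hxy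
      simp only [Set.mem_ofPred_eq, Finset.mem_insert] at hx hy
      by_cases hxc : F.connectedComponentMk x = c <;> by_cases hyc : F.connectedComponentMk y = c
        <;> simp only [hxc, hyc, dite_true, dite_false] at hxy
      · exact congrArg Subtype.val (hg hxy)
      · exact absurd hxy (hgf _ _ (hy.resolve_left hyc))
      · exact absurd hxy.symm (hgf _ _ (hx.resolve_left hxc))
      · exact hf (hx.resolve_left hxc) (hy.resolve_left hyc) hxy
    · intro x y hx hxy
      have hcomp : F.connectedComponentMk y = F.connectedComponentMk x :=
        SimpleGraph.ConnectedComponent.sound hxy.symm.reachable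
      by_cases hxc : F.connectedComponentMk x = c
      · have hyc : F.connectedComponentMk y = c := hcomp.trans hxc
        simp only [hxc, hyc, dite_true]
        exact hgadj ⟨x, hxc⟩ ⟨y, hyc⟩ hxy
      · have hyc : F.connectedComponentMk y ≠ c := fun h => hxc (hcomp.symm.trans h)
        simp only [hxc, hyc, dite_false]
        exact hadj x y ((Finset.mem_insert.1 hx).resolve_left hxc) hxy

/-! ### Forest-free graphs have large independent cliques -/

/-- Let `H` be a graph on `(j₀ - 1)(s + 1) + tailSum F j₀` vertices in which only the vertex `v` has
nonneighbours, and at most `j₀ - 2` of them. If `G` does not contain the forest `F`, then `H` has a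
clique of `s + 3` vertices that is independent in `G`. -/
theorem exists_isClique_isIndepSet_of_not_isContained {V X : Type*} [Finite V] [Fintype X]
    {F : SimpleGraph V} (hF : F.IsAcyclic) (hisolated : ∀ v, ∃ w, F.Adj v w) {s j₀ : ℕ}
    (hle : ∀ l ∈ componentSizes F, (l - 1) * (s + 1) + tailSum F l ≤ Fintype.card X)
    (hlt : ∀ l ∈ componentSizes F, l < j₀ → (l - 1) * (s + 1) + tailSum F l < Fintype.card X)
    {G H : SimpleGraph X} {v : X} (hH : ∀ x y, x ≠ y → x ≠ v → y ≠ v → H.Adj x y)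
    {D : Finset X} (hD : D.card + 2 ≤ j₀) (hvD : ∀ y, y ≠ v → y ∉ D → H.Adj v y)
    (hFG : ¬ F.IsContained G) :
    ∃ I : Finset X, I.card = s + 3 ∧ H.IsClique (I : Set X) ∧ G.IsIndepSet (I : Set X) := by
  suffices ∃ I : Finset X, s + 3 ≤ I.card ∧ H.IsClique (I : Set X) ∧ G.IsIndepSet (I : Set X) by
    obtain ⟨I, hI, hIH, hIG⟩ := this
    obtain ⟨J, hJI, hJ⟩ := Finset.exists_subset_card_eq hI
    exact ⟨J, hJ, hIH.subset (Finset.coe_subset.2 hJI),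
      Set.Pairwise.mono (Finset.coe_subset.2 hJI) hIG⟩
  by_contra! hno
  have hclique : ∀ I : Finset X, v ∉ I → H.IsClique (I : Set X) := fun I hv x hx y hy hxy =>
    hH x y hxy (fun h => hv (h ▸ hx)) (fun h => hv (h ▸ hy))
  refine hFG (isContained_of_forall_component F G fun c U hU => ?_)
  have hT : c.toSimpleGraph.IsTree := hF.isTree_connectedComponent c
  set j := c.supp.ncard with hj
  have hcard : Nat.card c = j := rfl
  have hjC : j ∈ componentSizes F := mem_componentSizes_iff.2 ⟨c, rfl⟩
  have hj2 : 2 ≤ j := two_le_ncard_supp hisolated c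
  have hsmall : ∀ I : Finset X, v ∉ I → G.IsIndepSet (I : Set X) → I.card ≤ s + 2 :=
    fun I hv hI => by
      by_contra! hcon
      exact hno I hcon (hclique I hv) hI
  have hbig : ∀ U' : Finset X, v ∉ U' → (j - 1) * (s + 2) < U'.card →
      EmbedsIn c.toSimpleGraph G U' := by
    intro U' hv hU'
    by_contra hcon
    obtain ⟨I, hIU, hI, hIc⟩ := exists_isIndepSet_of_not_embedsIn hT U' hcon
    have h1 := hsmall I (fun h => hv (hIU h)) hI
    rw [hcard] at hIc
    have := Nat.mul_le_mul_left (j - 1) h1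
    omega
  have hmul : (j - 1) * (s + 2) = (j - 1) * (s + 1) + (j - 1) := by ring
  have hUcard : (j - 1) * (s + 2) + 1 ≤ U.card := by
    have := hle j hjC
    omega
  by_cases hvU : v ∉ U
  · exact hbig U hvU hUcard
  rw [not_not] at hvU
  have herase := Finset.card_erase_add_one hvU
  -- Below `j₀` the strict inequality `hlt` pays for discarding `v`. From `j₀` on, `D` has at most
  -- `j - 2` vertices and the extremal case applies.
  by_cases hjj : j < j₀
  · refine (hbig (U.erase v) (Finset.notMem_erase v U) ?_).mono (Finset.erase_subset _ _)
    have := hlt j hjC hjj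
    omega
  by_contra hcon
  obtain ⟨I, hIU, hI, hIc⟩ := exists_isIndepSet_insert_of_not_embedsIn hT (U := U.erase v) (D := D)
    (v := v) (by omega) (Finset.notMem_erase v U) (by omega)
    (by rwa [Finset.insert_erase hvU]) (fun I hIU hI => by
      have h1 := hsmall I (fun h => Finset.notMem_erase v U (hIU h)) hI
      rw [hcard]
      have := Nat.mul_le_mul_left (j - 1) h1
      omega)
  have hvI : v ∉ I := fun h => Finset.notMem_erase v U (Finset.mem_sdiff.1 (hIU h)).1
  have hIs : s + 2 ≤ I.card := by
    rw [hcard] at hIc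
    have hle' : (j - 1) * (s + 2) ≤ (j - 1) * I.card := by omega
    exact Nat.le_of_mul_le_mul_left hle' (by omega)
  refine hno (insert v I) (by rw [Finset.card_insert_of_notMem hvI]; omega) ?_ hI
  rw [Finset.coe_insert]
  refine (hclique I hvI).insert fun y hy hyv => ?_
  exact hvD y (Ne.symm hyv) (Finset.mem_sdiff.1 (hIU hy)).2

/-! ### Arrowing and colourings that avoid it -/

theorem Arrows.mono {X Y : Type*} {G : SimpleGraph X} {G' : SimpleGraph Y} {t : ℕ}
    {A : Fin t → BundledGraph.{u}} (h : Arrows G A) (hG : G.IsContained G') : Arrows G' A := by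
  intro c
  obtain ⟨f⟩ := hG
  obtain ⟨i, hi⟩ := h (c.pullback f.toHom)
  refine ⟨i, hi.trans ⟨⟨⟨f, fun {x y} hxy => ?_⟩, f.injective⟩⟩⟩
  obtain ⟨hadj, hc⟩ := (SimpleGraph.EdgeLabeling.labelGraph_adj x y).1 hxy
  exact (SimpleGraph.EdgeLabeling.labelGraph_adj _ _).2 ⟨f.toHom.map_adj hadj, hc⟩

theorem not_arrows_of_lt_ramseyNumber {t : ℕ} {A : Fin t → BundledGraph.{u}} {n : ℕ} (hn : 0 < n)
    (hlt : n < ramseyNumber A) : ¬ Arrows (⊤ : SimpleGraph (Fin n)) A :=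
  fun h => Nat.notMem_of_lt_sInf hlt ⟨hn, h⟩

/-- Positivity rules out the default value `0` of the infimum of the empty set. -/
theorem arrows_ramseyNumber {t : ℕ} {A : Fin t → BundledGraph.{u}} (h : 0 < ramseyNumber A) :
    Arrows (⊤ : SimpleGraph (Fin (ramseyNumber A))) A :=
  (Nat.sInf_mem (Nat.nonempty_of_pos_sInf h)).2

/-- The first colour is used on `R` and the other colours are pulled back along `p`. -/
theorem not_arrows_cons_of_not_isContained {V : Type u} {X Y : Type*} {F : SimpleGraph V} {t : ℕ}
    {m : Fin t → ℕ} (hY : ¬ Arrows (⊤ : SimpleGraph Y) fun i => K.{u} (m i))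
    {H R : SimpleGraph X} (p : X → Y) (hp : ∀ x y, H.Adj x y → ¬ R.Adj x y → p x ≠ p y)
    (hR : ¬ F.IsContained R) :
    ¬ Arrows H (Fin.cons ⟨V, F⟩ fun i => K.{u} (m i) : Fin (t + 1) → BundledGraph.{u}) := by
  intro hH
  refine hY fun c₀ => ?_
  let c : H.EdgeLabeling (Fin (t + 1)) := SimpleGraph.EdgeLabeling.mk
    (fun x y hxy => if h : R.Adj x y then 0 else (c₀.get (p x) (p y) (hp x y hxy h)).succ)
    (fun x y hxy => by
      by_cases h : R.Adj x y
      · simp [h, h.symm]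
      · have h' : ¬ R.Adj y x := fun h' => h h'.symm
        simp only [h, h', dite_false]
        rw [SimpleGraph.EdgeLabeling.get_comm])
  have hc : ∀ x y (hxy : H.Adj x y), c ⟨s(x, y), hxy⟩ =
      if h : R.Adj x y then 0 else (c₀.get (p x) (p y) (hp x y hxy h)).succ := fun _ _ _ => rfl
  obtain ⟨i, hi⟩ := hH c
  induction i using Fin.cases with
  | zero =>
    refine absurd (hi.mono_right fun x y hxy => ?_) hR
    obtain ⟨hadj, h⟩ := (SimpleGraph.EdgeLabeling.labelGraph_adj x y).1 hxy
    rw [hc] at h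
    by_contra hn
    simp [hn] at h
  | succ i =>
    obtain ⟨f⟩ : (K.{u} (m i)).2.IsContained (c.labelGraph i.succ) := hi
    -- Distinct vertices of a complete graph are adjacent, so preserving adjacency already makes the
    -- composite with `p` injective.
    have key : ∀ a b, (K.{u} (m i)).2.Adj a b → (c₀.labelGraph i).Adj (p (f a)) (p (f b)) := by
      intro a b hab
      obtain ⟨hadj, h⟩ := (SimpleGraph.EdgeLabeling.labelGraph_adj _ _).1 (f.toHom.map_adj hab)
      rw [hc] at h
      by_cases hR : R.Adj (f.toHom a) (f.toHom b)
      · simp only [hR, dite_true] at h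
        exact absurd h (Fin.succ_ne_zero i).symm
      · simp only [hR, dite_false] at h
        exact (SimpleGraph.EdgeLabeling.labelGraph_adj _ _).2 ⟨_, Fin.succ_injective _ h⟩
    refine ⟨i, ⟨⟨⟨fun a => p (f a), fun {a b} hab => key a b hab⟩, fun a b hab => ?_⟩⟩⟩
    by_contra hne
    exact (key a b hne).ne hab

/-- If no edge of `H` inside a part of `p` leaves `A`, and `A` has fewer than `tailSum F j` vertices
in the part `i₀` and fewer than `j` vertices in every other part, then `H` does not arrow. -/
theorem not_arrows_cons_of_partition {V : Type u} [Finite V] {X Y : Type*} [Finite X]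
    [DecidableEq Y] {F : SimpleGraph V} (hisolated : ∀ v, ∃ w, F.Adj v w) {t : ℕ}
    {m : Fin t → ℕ} (hY : ¬ Arrows (⊤ : SimpleGraph Y) fun i => K.{u} (m i)) {j : ℕ}
    {H : SimpleGraph X} (p : X → Y) (A : Finset X)
    (hA : ∀ x y, H.Adj x y → p x = p y → x ∈ A ∧ y ∈ A) (i₀ : Y)
    (h₀ : (A.filter fun x => p x = i₀).card < tailSum F j)
    (h₁ : ∀ i, i ≠ i₀ → (A.filter fun x => p x = i).card < j) :
    ¬ Arrows H (Fin.cons ⟨V, F⟩ fun i => K.{u} (m i) : Fin (t + 1) → BundledGraph.{u}) := by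
  let R : SimpleGraph X :=
    { Adj := fun x y => x ≠ y ∧ (x ∈ A ∧ y ∈ A) ∧ p x = p y
      symm := ⟨fun x y h => ⟨h.1.symm, h.2.1.symm, h.2.2.symm⟩⟩
      loopless := ⟨fun x h => h.1 rfl⟩ }
  refine not_arrows_cons_of_not_isContained (R := R) hY p
    (fun x y hxy hn h => hn ⟨hxy.ne, hA x y hxy h, h⟩) ?_
  rintro ⟨f⟩
  -- This is where isolated vertices must be excluded: every vertex of the copy lies on an edge of
  -- `R`.
  have hmem : ∀ v, f v ∈ A := fun v => by
    obtain ⟨w, hw⟩ := hisolated v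
    exact (f.toHom.map_adj hw).2.1.1
  have hreach : ∀ v w, F.Reachable v w → p (f v) = p (f w) := by
    rintro v w ⟨q⟩
    induction q with
    | nil => rfl
    | cons h _ ih => exact (f.toHom.map_adj h).2.2.trans ih
  -- A component stays within one part, and only `i₀` has room for `j` vertices; hence all large
  -- components would share `i₀`.
  have hbig : ∀ v, j ≤ (F.connectedComponentMk v).supp.ncard → p (f v) = i₀ := by
    intro v hv
    by_contra hne
    refine absurd (h₁ _ hne) (not_lt.2 (hv.trans ?_))
    rw [← Set.ncard_coe_finset]
    refine Set.ncard_le_ncard_of_injOn f (fun w hw => ?_) f.injective.injOn (Set.toFinite _)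
    have hw' : F.Reachable w v := SimpleGraph.ConnectedComponent.exact hw
    simpa using ⟨hmem w, hreach w v hw'⟩
  refine absurd h₀ (not_lt.2 ?_)
  rw [tailSum_eq_ncard, ← Set.ncard_coe_finset]
  refine Set.ncard_le_ncard_of_injOn f (fun w hw => ?_) f.injective.injOn (Set.toFinite _)
  simpa using ⟨hmem w, hbig w hw⟩

/-- Distributes vertices among parts of prescribed capacities, by injecting `Z` into the disjoint
union of the slots. Values outside `Z` are irrelevant. -/
theorem exists_card_fiber_le {X ι : Type*} [Fintype ι] [DecidableEq ι] [Nonempty ι]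
    (Z : Finset X) (a : ι → ℕ)
    (h : Z.card ≤ ∑ i, a i) : ∃ p : X → ι, ∀ i, (Z.filter fun x => p x = i).card ≤ a i := by
  obtain ⟨e⟩ : Nonempty (Z ↪ Σ i, Fin (a i)) :=
    Function.Embedding.nonempty_of_card_le (by simpa using h)
  refine ⟨fun x => if hx : x ∈ Z then (e ⟨x, hx⟩).1 else Classical.arbitrary ι, fun i => ?_⟩
  have hsub : (Z.filter fun x => (if hx : x ∈ Z then (e ⟨x, hx⟩).1 else Classical.arbitrary ι) = i)
      ⊆ (Finset.univ : Finset (Fin (a i))).biUnion fun k =>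
        (Z.attach.filter fun z => e z = ⟨i, k⟩).image Subtype.val := by
    intro x hx
    obtain ⟨hxZ, hxi⟩ := Finset.mem_filter.1 hx
    simp only [hxZ, dite_true] at hxi
    subst hxi
    simp only [Finset.mem_biUnion, Finset.mem_image, Finset.mem_filter]
    exact ⟨(e ⟨x, hxZ⟩).2, Finset.mem_univ _, ⟨x, hxZ⟩, ⟨Finset.mem_attach _ _, rfl⟩, rfl⟩
  refine (Finset.card_le_card hsub).trans ((Finset.card_biUnion_le_card_mul _ _ 1 ?_).trans ?_)
  · intro k _
    refine Finset.card_image_le.trans (Finset.card_le_one.2 fun z hz w hw => ?_)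
    exact e.injective ((Finset.mem_filter.1 hz).2.trans (Finset.mem_filter.1 hw).2.symm)
  · simp

theorem tailSum_pos {V : Type*} [Finite V] {F : SimpleGraph V} {j : ℕ}
    (hisolated : ∀ v, ∃ w, F.Adj v w) (hj : j ∈ componentSizes F) : 0 < tailSum F j := by
  obtain ⟨c, rfl⟩ := mem_componentSizes_iff.1 hj
  have := two_le_ncard_supp hisolated c
  have := ncard_supp_le_tailSum F c
  omega

/-- The lower bound for the Ramsey number. -/
theorem not_arrows_cons_of_card_lt {V : Type u} [Finite V] {X : Type*} [Fintype X]
    {F : SimpleGraph V} (hisolated : ∀ v, ∃ w, F.Adj v w) {t s : ℕ}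
    {m : Fin t → ℕ} (hY : ¬ Arrows (⊤ : SimpleGraph (Fin (s + 2))) fun i => K.{u} (m i)) {j : ℕ}
    (hj : j ∈ componentSizes F) (hj0 : 0 < j) (H : SimpleGraph X)
    (hX : Fintype.card X < (j - 1) * (s + 1) + tailSum F j) :
    ¬ Arrows H (Fin.cons ⟨V, F⟩ fun i => K.{u} (m i) : Fin (t + 1) → BundledGraph.{u}) := by
  have hpos := tailSum_pos hisolated hj
  obtain ⟨p, hp⟩ := exists_card_fiber_le (Finset.univ : Finset X)
    (Fin.cons (tailSum F j - 1) fun _ => j - 1 : Fin (s + 2) → ℕ) (by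
      rw [Fin.sum_univ_succ]
      simp only [Finset.card_univ, Fin.cons_zero, Fin.cons_succ, Finset.sum_const,
        Fintype.card_fin, smul_eq_mul]
      rw [mul_comm (s + 1)]
      omega)
  refine not_arrows_cons_of_partition (j := j) hisolated hY p Finset.univ (by simp) 0 ?_ ?_
  · have := hp 0
    rw [Fin.cons_zero] at this
    omega
  · intro i hi
    obtain ⟨k, rfl⟩ := Fin.exists_succ_eq.2 hi
    have := hp k.succ
    rw [Fin.cons_succ] at this
    omega

/-- The lower bound for the star-critical Ramsey number. -/
theorem not_arrows_cons_of_nonneighbors {V : Type u} [Finite V] {X : Type*} [Fintype X]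
    {F : SimpleGraph V} (hisolated : ∀ v, ∃ w, F.Adj v w) {t s : ℕ}
    {m : Fin t → ℕ} (hY : ¬ Arrows (⊤ : SimpleGraph (Fin (s + 2))) fun i => K.{u} (m i)) {j : ℕ}
    (hj : j ∈ componentSizes F) (hj0 : 0 < j) (H : SimpleGraph X)
    (hX : Fintype.card X ≤ (j - 1) * (s + 1) + tailSum F j) (v : X) (D : Finset X)
    (hvD : v ∉ D) (hD : j ≤ D.card + 1) (hadj : ∀ y ∈ D, ¬ H.Adj v y) :
    ¬ Arrows H (Fin.cons ⟨V, F⟩ fun i => K.{u} (m i) : Fin (t + 1) → BundledGraph.{u}) := by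
  have hpos := tailSum_pos hisolated hj
  obtain ⟨E, hED, hE⟩ := Finset.exists_subset_card_eq (show j - 1 ≤ D.card by omega)
  have hvE : v ∉ E := fun h => hvD (hED h)
  -- Part `1` gets capacity `0` because it is reserved for `v` and its `j - 1` chosen nonneighbours
  -- `E`.
  obtain ⟨p, hp⟩ := exists_card_fiber_le (Finset.univ \ insert v E)
    (Fin.cons (tailSum F j - 1) (Fin.cons 0 fun _ => j - 1) : Fin (s + 2) → ℕ) (by
      have h1 := Finset.card_sdiff_add_card_eq_card (Finset.subset_univ (insert v E))
      rw [Finset.card_insert_of_notMem hvE, hE, Finset.card_univ] at h1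
      rw [Fin.sum_univ_succ, Fin.sum_univ_succ]
      simp only [Fin.cons_zero, Fin.cons_succ, Finset.sum_const, Finset.card_univ,
        Fintype.card_fin, smul_eq_mul]
      have h2 : (j - 1) * (s + 1) = s * (j - 1) + (j - 1) := by ring
      omega)
  have hp1 : ∀ x, x ∉ insert v E → p x ≠ 1 := by
    intro x hx h
    have h1 : (Fin.cons (tailSum F j - 1) (Fin.cons 0 fun _ => j - 1) : Fin (s + 2) → ℕ) 1 = 0 :=
      rfl
    have h2 := hp 1
    rw [h1, Nat.le_zero, Finset.card_eq_zero] at h2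
    exact Finset.notMem_empty x (h2 ▸ Finset.mem_filter.2 ⟨by simpa using hx, h⟩)
  have hq1 : ∀ x, (if x ∈ insert v E then 1 else p x) = 1 → x = v ∨ x ∈ E := by
    intro x hx
    by_contra hcon
    have hx' : x ∉ insert v E := by rwa [Finset.mem_insert]
    rw [if_neg hx'] at hx
    exact hp1 x hx' hx
  have hv : ∀ y, H.Adj v y → (if y ∈ insert v E then 1 else p y) ≠ 1 := by
    intro y hvy hy
    rcases hq1 y hy with rfl | hyE
    · exact hvy.ne rfl
    · exact hadj y (hED hyE) hvy
  have hother : ∀ i, i ≠ 1 → ((Finset.univ.erase v).filter fun x =>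
      (if x ∈ insert v E then 1 else p x) = i).card
        ≤ ((Finset.univ \ insert v E).filter fun x => p x = i).card := by
    intro i hi
    refine Finset.card_le_card fun x hx => ?_
    obtain ⟨-, hx⟩ := Finset.mem_filter.1 hx
    by_cases hxE : x ∈ insert v E
    · rw [if_pos hxE] at hx
      exact absurd hx.symm hi
    · rw [if_neg hxE] at hx
      exact Finset.mem_filter.2 ⟨by simpa using hxE, hx⟩
  -- Leaving `v` out of the set `A` is harmless, as `v` has no neighbour in its own part; what
  -- remains of part `1` is `E`, with fewer than `j` vertices.
  refine not_arrows_cons_of_partition (j := j) hisolated hY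
    (fun x => if x ∈ insert v E then 1 else p x) (Finset.univ.erase v) ?_ 0 ?_ ?_
  · intro x y hxy hpxy
    simp only [Finset.mem_erase, Finset.mem_univ, and_true]
    have hvv : (if v ∈ insert v E then 1 else p v) = 1 := if_pos (Finset.mem_insert_self _ _)
    constructor
    · rintro rfl
      exact hv y hxy (hpxy.symm.trans hvv)
    · rintro rfl
      exact hv x hxy.symm (hpxy.trans hvv)
  · refine (hother 0 (by simp)).trans_lt ?_
    have := hp 0
    rw [Fin.cons_zero] at this
    omega
  · intro i hi
    obtain ⟨k, rfl⟩ := Fin.exists_succ_eq.2 hi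
    induction k using Fin.cases with
    | zero =>
      refine (Finset.card_le_card (t := E) fun x hx => ?_).trans_lt (by omega)
      obtain ⟨hxv, hx⟩ := Finset.mem_filter.1 hx
      exact (hq1 x hx).resolve_left (Finset.ne_of_mem_erase hxv)
    | succ k =>
      refine (hother _ ?_).trans_lt ?_
      · exact fun h => Fin.succ_ne_zero k (Fin.succ_injective _ h)
      · have := hp k.succ.succ
        rw [Fin.cons_succ, Fin.cons_succ] at this
        omega

/-! ### Upper bound and evaluation of both Ramsey numbers -/

/-- The upper bound for the star-critical Ramsey number. -/
theorem arrows_cons_of_nonneighbors {V : Type u} [Finite V] {X : Type*} [Fintype X]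
    {F : SimpleGraph V} (hF : F.IsAcyclic) (hisolated : ∀ v, ∃ w, F.Adj v w) {s t j₀ : ℕ}
    {m : Fin t → ℕ} (hK : Arrows (⊤ : SimpleGraph (Fin (s + 3))) fun i => K.{u} (m i))
    (hle : ∀ l ∈ componentSizes F, (l - 1) * (s + 1) + tailSum F l ≤ Fintype.card X)
    (hlt : ∀ l ∈ componentSizes F, l < j₀ → (l - 1) * (s + 1) + tailSum F l < Fintype.card X)
    {H : SimpleGraph X} {v : X} (hH : ∀ x y, x ≠ y → x ≠ v → y ≠ v → H.Adj x y)
    {D : Finset X} (hD : D.card + 2 ≤ j₀) (hvD : ∀ y, y ≠ v → y ∉ D → H.Adj v y) :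
    Arrows H (Fin.cons ⟨V, F⟩ fun i => K.{u} (m i) : Fin (t + 1) → BundledGraph.{u}) := by
  intro c
  by_cases hFc : F.IsContained (c.labelGraph 0)
  · exact ⟨0, hFc⟩
  obtain ⟨I, hI, hIH, hIG⟩ :=
    exists_isClique_isIndepSet_of_not_isContained hF hisolated hle hlt hH hD hvD hFc
  let e : Fin (s + 3) ≃ I := (I.equivFinOfCardEq hI).symm
  have hinj : ∀ {x y}, x ≠ y → (e x : X) ≠ e y := fun hxy h => hxy (e.injective (Subtype.ext h))
  have hadj : ∀ {x y}, x ≠ y → H.Adj (e x) (e y) := fun {x y} hxy =>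
    hIH (e x).2 (e y).2 (hinj hxy)
  have hne : ∀ {x y} (hxy : x ≠ y), c.get (e x) (e y) (hadj hxy) ≠ 0 := fun {x y} hxy h =>
    hIG (e x).2 (e y).2 (hinj hxy) ((SimpleGraph.EdgeLabeling.labelGraph_adj _ _).2 ⟨_, h⟩)
  let c' : (⊤ : SimpleGraph (Fin (s + 3))).EdgeLabeling (Fin t) := SimpleGraph.EdgeLabeling.mk
    (fun x y hxy => (c.get (e x) (e y) (hadj hxy)).pred (hne hxy))
    (fun x y hxy => by congr 1; rw [SimpleGraph.EdgeLabeling.get_comm])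
  obtain ⟨i, hi⟩ := hK c'
  refine ⟨i.succ, hi.trans (B := c'.labelGraph i)
    ⟨⟨⟨fun x => (e x : X), fun {x y} hxy => ?_⟩, fun x y h => e.injective (Subtype.ext h)⟩⟩⟩
  obtain ⟨hxy', h⟩ := (SimpleGraph.EdgeLabeling.labelGraph_adj x y).1 hxy
  refine (SimpleGraph.EdgeLabeling.labelGraph_adj _ _).2 ⟨hadj hxy', ?_⟩
  have h' : (c.get (e x) (e y) (hadj hxy')).pred (hne hxy') = i := h
  rw [← h', Fin.succ_pred]
  rfl

/-- The complete graph with the edges from `v` to `D` removed. -/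
def deleteStar {X : Type*} (v : X) (D : Finset X) : SimpleGraph X where
  Adj x y := x ≠ y ∧ ¬ (x = v ∧ y ∈ D) ∧ ¬ (y = v ∧ x ∈ D)
  symm := ⟨fun _ _ h => ⟨h.1.symm, h.2.2, h.2.1⟩⟩
  loopless := ⟨fun _ h => h.1 rfl⟩

theorem ramseyNumber_cons {V : Type u} [Finite V] {F : SimpleGraph V} (hF : F.IsAcyclic)
    (hisolated : ∀ v, ∃ w, F.Adj v w) {s t j₀ : ℕ} {m : Fin t → ℕ}
    (hr : ramseyNumber (fun i => K.{u} (m i)) = s + 3) (hj₀ : j₀ ∈ componentSizes F)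
    (hle : ∀ l ∈ componentSizes F,
      (l - 1) * (s + 1) + tailSum F l ≤ (j₀ - 1) * (s + 1) + tailSum F j₀)
    (hlt : ∀ l ∈ componentSizes F, l < j₀ →
      (l - 1) * (s + 1) + tailSum F l < (j₀ - 1) * (s + 1) + tailSum F j₀) :
    ramseyNumber (Fin.cons ⟨V, F⟩ fun i => K.{u} (m i) : Fin (t + 1) → BundledGraph.{u}) =
      (j₀ - 1) * (s + 1) + tailSum F j₀ := by
  have hj2 : 2 ≤ j₀ := by
    obtain ⟨c, rfl⟩ := mem_componentSizes_iff.1 hj₀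
    exact two_le_ncard_supp hisolated c
  have hpos := tailSum_pos hisolated hj₀
  have hK := arrows_ramseyNumber (A := fun i => K.{u} (m i)) (by omega)
  have hY := not_arrows_of_lt_ramseyNumber (A := fun i => K.{u} (m i)) (n := s + 2) (by omega)
    (by omega)
  rw [hr] at hK
  have hmem : (j₀ - 1) * (s + 1) + tailSum F j₀ ∈
      {n : ℕ | 0 < n ∧ Arrows (⊤ : SimpleGraph (Fin n))
        (Fin.cons ⟨V, F⟩ fun i => K.{u} (m i) : Fin (t + 1) → BundledGraph.{u})} := by
    -- The complete graph is the case `D = ∅`, with an arbitrary vertex as `v`.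
    refine ⟨by omega, arrows_cons_of_nonneighbors (j₀ := j₀) (v := ⟨0, by omega⟩) (D := ∅) hF
      hisolated hK ?_ ?_ ?_ ?_ ?_⟩
    · simpa using hle
    · simpa using hlt
    · exact fun x y hxy _ _ => hxy
    · simpa using hj2
    · exact fun y hy _ => hy.symm
  refine le_antisymm (Nat.sInf_le hmem) (le_csInf ⟨_, hmem⟩ ?_)
  rintro n ⟨-, hn⟩
  by_contra hcon
  exact not_arrows_cons_of_card_lt hisolated hY hj₀ (by omega) _ (by simpa using hcon) hn

theorem starCriticalRamseyNumber_cons {V : Type u} [Finite V] {F : SimpleGraph V}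
    (hF : F.IsAcyclic) (hisolated : ∀ v, ∃ w, F.Adj v w) {s t j₀ : ℕ} {m : Fin t → ℕ}
    (hr : ramseyNumber (fun i => K.{u} (m i)) = s + 3) (hj₀ : j₀ ∈ componentSizes F)
    (hle : ∀ l ∈ componentSizes F,
      (l - 1) * (s + 1) + tailSum F l ≤ (j₀ - 1) * (s + 1) + tailSum F j₀)
    (hlt : ∀ l ∈ componentSizes F, l < j₀ →
      (l - 1) * (s + 1) + tailSum F l < (j₀ - 1) * (s + 1) + tailSum F j₀) :
    starCriticalRamseyNumber
        (Fin.cons ⟨V, F⟩ fun i => K.{u} (m i) : Fin (t + 1) → BundledGraph.{u}) =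
      (j₀ - 1) * s + tailSum F j₀ := by
  have hj2 : 2 ≤ j₀ := by
    obtain ⟨c, rfl⟩ := mem_componentSizes_iff.1 hj₀
    exact two_le_ncard_supp hisolated c
  have hS : j₀ ≤ tailSum F j₀ := by
    obtain ⟨c, rfl⟩ := mem_componentSizes_iff.1 hj₀
    exact ncard_supp_le_tailSum F c
  have hK := arrows_ramseyNumber (A := fun i => K.{u} (m i)) (by omega)
  have hY := not_arrows_of_lt_ramseyNumber (A := fun i => K.{u} (m i)) (n := s + 2) (by omega)
    (by omega)
  rw [hr] at hK
  have hmul : (j₀ - 1) * (s + 1) = (j₀ - 1) * s + (j₀ - 1) := by ring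
  rw [starCriticalRamseyNumber, ramseyNumber_cons hF hisolated hr hj₀ hle hlt]
  set M := (j₀ - 1) * (s + 1) + tailSum F j₀ with hM
  obtain ⟨H, hH, hHdeg⟩ : ∃ H : (⊤ : SimpleGraph (Fin M)).Subgraph,
      Arrows H.coe (Fin.cons ⟨V, F⟩ fun i => K.{u} (m i) : Fin (t + 1) → BundledGraph.{u}) ∧
        H.coe.minDegree ≤ (j₀ - 1) * s + tailSum F j₀ := by
    let v : Fin M := ⟨0, by omega⟩
    -- Deleting `j₀ - 2` edges at `v` is the most that the upper bound tolerates.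
    obtain ⟨D, hDsub, hD⟩ := Finset.exists_subset_card_eq
      (s := (Finset.univ : Finset (Fin M)).erase v) (n := j₀ - 2) (by
        rw [Finset.card_erase_of_mem (Finset.mem_univ _), Finset.card_univ, Fintype.card_fin]
        omega)
    have hvD : v ∉ D := fun h => Finset.notMem_erase _ _ (hDsub h)
    have harr : Arrows (deleteStar v D)
        (Fin.cons ⟨V, F⟩ fun i => K.{u} (m i) : Fin (t + 1) → BundledGraph.{u}) := by
      refine arrows_cons_of_nonneighbors (j₀ := j₀) (v := v) (D := D) hF hisolated hK ?_ ?_ ?_ ?_ ?_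
      · simpa using hle
      · simpa using hlt
      · exact fun x y hxy hx hy => ⟨hxy, fun h => hx h.1, fun h => hy h.1⟩
      · omega
      · exact fun y hy hyD => ⟨hy.symm, fun h => hyD h.2, fun h => hy h.1⟩
    refine ⟨SimpleGraph.toSubgraph (deleteStar v D) le_top, harr.mono ?_, ?_⟩
    · exact ⟨⟨⟨fun x => ⟨x, trivial⟩, fun h => h⟩, fun x y h => congrArg Subtype.val h⟩⟩
    · refine (SimpleGraph.minDegree_le_degree _ ⟨v, trivial⟩).trans ?_
      rw [← SimpleGraph.card_neighborFinset_eq_degree]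
      have h1 : (Finset.univ \ insert v D).card + (j₀ - 1) = M := by
        have := Finset.card_sdiff_add_card_eq_card (Finset.subset_univ (insert v D))
        rw [Finset.card_insert_of_notMem hvD, hD, Finset.card_univ, Fintype.card_fin] at this
        omega
      refine (Finset.card_le_card_of_injOn (t := Finset.univ \ insert v D) Subtype.val ?_
        Subtype.val_injective.injOn).trans (by omega)
      intro x hx
      have hx' : (deleteStar v D).Adj v x := by simpa using hx
      simpa using ⟨hx'.1.symm, fun h => hx'.2.1 ⟨rfl, h⟩⟩
  refine le_antisymm (le_trans (Nat.sInf_le ?_) hHdeg) (le_csInf ?_ ?_)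
  · exact ⟨H, hH, rfl⟩
  · exact ⟨_, H, hH, rfl⟩
  rintro d ⟨H, hH, rfl⟩
  -- An arrowing subgraph must span all `M` vertices, by the lower bound for the Ramsey number.
  have hcard : M ≤ Fintype.card H.verts := by
    by_contra! hcon
    exact not_arrows_cons_of_card_lt hisolated hY hj₀ (by omega) _ hcon hH
  have hcard' : Fintype.card H.verts ≤ M := by
    simpa using Fintype.card_subtype_le (· ∈ H.verts)
  have hne : Nonempty H.verts := Fintype.card_pos_iff.1 (by omega)
  obtain ⟨v, hv⟩ := H.coe.exists_minimal_degree_vertex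
  suffices key : ∀ N : Finset H.verts, (∀ y, y ∈ N ↔ H.coe.Adj v y) →
      (j₀ - 1) * s + tailSum F j₀ ≤ N.card by
    rw [hv, ← SimpleGraph.card_neighborFinset_eq_degree]
    exact key _ (by simp)
  intro N hN
  by_contra! hcon
  refine not_arrows_cons_of_nonneighbors hisolated hY hj₀ (by omega) H.coe hcard' v
    (Finset.univ \ insert v N) (by simp) ?_ (fun y hy h => ?_) hH
  -- A degree below the claimed value leaves at least `j₀ - 1` nonneighbours.
  · have h1 := Finset.card_sdiff_add_card_eq_card (Finset.subset_univ (insert v N))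
    have h2 := Finset.card_insert_le v N
    rw [Finset.card_univ] at h1
    omega
  · exact (Finset.mem_sdiff.1 hy).2 (Finset.mem_insert_of_mem ((hN y).2 h))

end ForestRamsey

theorem mainTheorem1 {V : Type u} [Finite V] (F : SimpleGraph V)
    (hF : F.IsAcyclic) (hisolated : ∀ v, ∃ w, F.Adj v w)
    {t : ℕ} (m : Fin t → ℕ) (hm : ∀ i, 0 < m i)
    (r : ℕ) (hr : r = ForestRamsey.ramseyNumber fun i => ForestRamsey.K.{u} (m i))
    (hr3 : 3 ≤ r)
    (j₀ : ℕ)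
    (hj₀ : IsLeast
      {j | j ∈ ForestRamsey.componentSizes F ∧
        ∀ l ∈ ForestRamsey.componentSizes F,
          ((l : ℤ) - 1) * ((r : ℤ) - 2) + (ForestRamsey.tailSum F l : ℤ) ≤
            ((j : ℤ) - 1) * ((r : ℤ) - 2) + (ForestRamsey.tailSum F j : ℤ)} j₀) :
    (ForestRamsey.starCriticalRamseyNumber
        (Fin.cons ⟨V, F⟩ fun i => ForestRamsey.K.{u} (m i)) : ℤ) =
      ((j₀ : ℤ) - 1) * ((r : ℤ) - 3) + (ForestRamsey.tailSum F j₀ : ℤ) := by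
  obtain ⟨s, rfl⟩ := Nat.exists_eq_add_of_le' hr3
  obtain ⟨⟨hj, hmax⟩, hmin⟩ := hj₀
  have hpos : ∀ l ∈ ForestRamsey.componentSizes F, 1 ≤ l := by
    intro l hl
    obtain ⟨c, rfl⟩ := ForestRamsey.mem_componentSizes_iff.1 hl
    exact (ForestRamsey.two_le_ncard_supp hisolated c).trans' (by norm_num)
  have hcast : ∀ l ∈ ForestRamsey.componentSizes F,
      ((l : ℤ) - 1) * (((s + 3 : ℕ) : ℤ) - 2) + (ForestRamsey.tailSum F l : ℤ) =
        (((l - 1) * (s + 1) + ForestRamsey.tailSum F l : ℕ) : ℤ) := by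
    intro l hl
    push_cast [Nat.cast_sub (hpos l hl)]
    ring
  have hle : ∀ l ∈ ForestRamsey.componentSizes F,
      (l - 1) * (s + 1) + ForestRamsey.tailSum F l ≤
        (j₀ - 1) * (s + 1) + ForestRamsey.tailSum F j₀ := by
    intro l hl
    have := hmax l hl
    rw [hcast l hl, hcast j₀ hj] at this
    exact_mod_cast this
  rw [ForestRamsey.starCriticalRamseyNumber_cons hF hisolated hr.symm hj hle]
  · push_cast [Nat.cast_sub (hpos j₀ hj)]
    ring
  -- A smaller `l` without strict inequality would also attain the maximum, against the minimality
  -- of `j₀`.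
  · intro l hl hlt
    by_contra! hcon
    refine absurd (hmin ⟨hl, fun k hk => ?_⟩) (not_le.2 hlt)
    rw [hcast k hk, hcast l hl]
    exact_mod_cast (hle k hk).trans hcon
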